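/- Let $V=\bigoplus_{n\in\frac12\mathbb Z}V_n$ be a vertex operator superalgebra over $\mathbb C$ with vacuum $\mathbf 1$ and conformal vector $\omega$ (vectors of integral weight are even, those of weight in $\mathbb Z+\frac12$ are odd; $L(0)$ acts on $V_n$ as $n$; a vertex operator algebra is the case where all weights are integers). Write $Y(u,x)=\sum_{n\in\mathbb Z}u(n)x^{-n-1}$, $Y^{+}(u,x)=\sum_{n\ge 0}u(n)x^{-n-1}$, $Y^{-}(u,x)=\sum_{n<0}u(n)x^{-n-1}$, and put $$X(v,y)=Y(y^{L(0)}v,y),\qquad Y[u,x]=Y(e^{xL(0)}u,e^x-1),$$ where negative powers of $e^x-1$ are the multiplicative inverses in $\mathbb C((x))$. For homogeneous $u,v$ of parities $p(u),p(v)$ let $$:\!X(u,y_1)X(v,y_2)\!:\;=\;y_1^{\mathrm{wt}(u)}y_2^{\mathrm{wt}(v)}\bigl(Y^{-}(u,y_1)Y(v,y_2)+(-1)^{p(u)p(v)}\,Y(v,y_2)Y^{+}(u,y_1)\bigr),$$ extended bilinearly. Functions of $x_1-x_2$ below are expanded in nonnegative powers of $x_2$. (1) For every homogeneous $u\in V$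 and every $v\in V$, $$X(Y[u,x]v,y)=\;:\!X(u,e^xy)X(v,y)\!:\;+\;X\bigl(e^{x\,\mathrm{wt}(u)}Y^{+}(u,e^x-1)v,\,y\bigr).$$ (2) Let $u,v$ be homogeneous and form a free pair with constant $c\in\mathbb C$, that is, $u(n)v=c\,\delta_{\mathrm{wt}(u)+\mathrm{wt}(v)-1,\,n}\mathbf 1$ for all $n\ge 0$. Put $$f(x)=c\,\frac{e^{x\,\mathrm{wt}(u)}}{(e^x-1)^{\mathrm{wt}(u)+\mathrm{wt}(v)}}$$ if $\mathrm{wt}(u)+\mathrm{wt}(v)$ is a positive integer, and $f=0$ otherwise. Then $$X(Y[u,x]v,y)=\;:\!X(u,e^xy)X(v,y)\!:\;+\;f(x),$$ and, more generally, $$X(Y[u,x_1-x_2]v,e^{x_2}y)=\;:\!X(u,e^{x_1}y)X(v,e^{x_2}y)\!:\;+\;f(x_1-x_2).$$ (3) Let $h\in V_1$ and $\varphi\in V_{1/2}$ be free fields, that is, $h(n)h=\delta_{n,1}\mathbf 1$, $\varphi(n)\varphi=\delta_{n,0}\mathbf 1$ and $h(n)\varphi=\varphi(n)h=0$ for all $n\ge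 0$ (for instance the generators $h(-1)\mathbf 1$ and $\varphi(-\frac12)\mathbf 1$ of the vertex operator superalgebra $M(1)\otimes F$ of one free boson and one free fermion). Define the $\zeta$-regularized normal ordering ${}^{+}_{+}\,\cdot\,{}^{+}_{+}$ of $X(u,e^{x_1}y)X(v,e^{x_2}y)$, bilinearly in $u,v\in\mathbb Ch+\mathbb C\varphi$, as $:\!X(u,e^{x_1}y)X(v,e^{x_2}y)\!:$ plus the scalar $-\frac{\partial}{\partial x_1}\frac{e^{x_1-x_2}}{e^{x_1-x_2}-1}$ if $u=v=h$, plus the scalar $\frac{e^{(x_1-x_2)/2}}{e^{x_1-x_2}-1}$ if $u=v=\varphi$, and plus $0$ if one of $u,v$ is $h$ and the other is $\varphi$. Then, for all $u,v\in\mathbb Ch+\mathbb C\varphi$, $${}^{+}_{+}X(u,e^{x_1}y)X(v,e^{x_2}y){}^{+}_{+}=X(Y[u,x_1-x_2]v,e^{x_2}y).$$ -/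

import Mathlib

noncomputable section

/-! ### Formal exponentials -/

/-- The formal series `e^{a x}`, as an element of the field `ℂ((x))`. -/
def expL (a : ℂ) : LaurentSeries ℂ :=
  ((PowerSeries.rescale a (PowerSeries.exp ℂ) : PowerSeries ℂ) : LaurentSeries ℂ)

/-- The formal series `e^x - 1`. Its negative integer powers are taken in the field `ℂ((x))`, that
is, they are the multiplicative inverses of its positive powers. -/
def expSubOne : LaurentSeries ℂ := expL 1 - 1

/-- If `f n` is the coefficient of `x^n` in a formal Laurent series `f(x)` (truncated from below),
then `atDiff f i j` is the coefficient of `x₁^i x₂^j` in `f(x₁ - x₂)`, where every power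
`(x₁ - x₂)^m`, `m ∈ ℤ`, is expanded in nonnegative powers of `x₂` by the binomial theorem. -/
def atDiff {M : Type*} [AddCommGroup M] (f : ℤ → M) (i : ℤ) (j : ℕ) : M :=
  ((-1 : ℤ) ^ j * Ring.choose (i + (j : ℤ)) j) • f (i + (j : ℤ))

/-! ### Vertex operator superalgebras -/

/-- The mode `u(n)` of the vertex operator `Y(u,x) = ∑ₙ u(n) x^{-n-1}`. -/
def modeOf {V : Type*} [AddCommGroup V] [Module ℂ V] (Y : V →ₗ[ℂ] VertexOperator ℂ V)
    (u : V) (n : ℤ) : Module.End ℂ V :=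
  VertexOperator.ncoeff (Y u) n

/-- A vertex operator superalgebra structure on a complex vector space `V`. A vertex operator
algebra is the special case in which `gr k = ⊥` for all odd `k`.

Weights lie in `½ℤ`, and all weights are doubled: `gr k` is the space of vectors of weight `k / 2`.
The vectors of integral weight are even, those of weight in `ℤ + ½` are odd, so a vector of `gr k`
has parity `k` mod `2`. The truncation property `Y(u,x)w ∈ V((x))` is part of the type
`VertexOperator ℂ V`. -/
structure VertexOperatorSuperalgebra (V : Type*) [AddCommGroup V] [Module ℂ V] where
  /-- the vertex operator map `u ↦ Y(u,x)` -/
  Y : V →ₗ[ℂ] VertexOperator ℂ V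
  /-- the vacuum vector -/
  vacuum : V
  /-- the conformal (Virasoro) vector; `L(n) = ω(n+1)` -/
  omega : V
  /-- the central charge -/
  charge : ℂ
  /-- `gr k` is the subspace of vectors of weight `k / 2` -/
  gr : ℤ → Submodule ℂ V
  isInternal : DirectSum.IsInternal gr
  vacuum_mem : vacuum ∈ gr 0
  omega_mem : omega ∈ gr 4
  /-- `Y(𝟏,x) = Id` -/
  vacuum_mode : ∀ n : ℤ, modeOf Y vacuum n = if n = -1 then 1 else 0
  /-- `Y(v,x)𝟏 ∈ V[[x]]` -/
  creation : ∀ (v : V) (n : ℤ), 0 ≤ n → modeOf Y v n vacuum = 0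
  /-- `lim_{x → 0} Y(v,x)𝟏 = v` -/
  creation_limit : ∀ v : V, modeOf Y v (-1) vacuum = v
  /-- The Jacobi identity
  `x₀⁻¹ δ((x₁-x₂)/x₀) Y(u,x₁) Y(v,x₂) - ε x₀⁻¹ δ((x₂-x₁)/(-x₀)) Y(v,x₂) Y(u,x₁)`
  `= x₂⁻¹ δ((x₁-x₀)/x₂) Y(Y(u,x₀)v,x₂)`, with `ε = (-1)^{p(u)p(v)}`, applied to `w`:
  the coefficient of `x₀^{-l-1} x₁^{-m-1} x₂^{-n-1}`. All three sums are finite, by truncation. -/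
  jacobi : ∀ (a b : ℤ) (u v w : V), u ∈ gr a → v ∈ gr b → ∀ l m n : ℤ,
    (∑ᶠ i : ℕ, ((-1 : ℤ) ^ i * Ring.choose l i) •
        modeOf Y u (l + m - i) (modeOf Y v (n + i) w)) -
      ((-1 : ℂ) ^ (a * b) * (-1 : ℂ) ^ l) •
        (∑ᶠ i : ℕ, ((-1 : ℤ) ^ i * Ring.choose l i) •
          modeOf Y v (l + n - i) (modeOf Y u (m + i) w)) =
    ∑ᶠ i : ℕ, Ring.choose m i • modeOf Y (modeOf Y u (l + i) v) (m + n - i) w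
  /-- the Virasoro relations for `L(n) = ω(n+1)` -/
  virasoro : ∀ m n : ℤ,
    modeOf Y omega (m + 1) * modeOf Y omega (n + 1)
        - modeOf Y omega (n + 1) * modeOf Y omega (m + 1) =
      ((m : ℂ) - n) • modeOf Y omega (m + n + 1)
        + (if m + n = 0 then ((m : ℂ) ^ 3 - m) / 12 * charge else 0) • (1 : Module.End ℂ V)
  /-- `L(0)` acts on a vector as multiplication by its weight -/
  L_zero : ∀ (k : ℤ) (v : V), v ∈ gr k → modeOf Y omega 1 v = ((k : ℂ) / 2) • v
  /-- `Y(L(-1)v,x) = d/dx Y(v,x)` -/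
  L_neg_one : ∀ (v : V) (n : ℤ),
    modeOf Y (modeOf Y omega 0 v) n = (-(n : ℂ)) • modeOf Y v (n - 1)

namespace VertexOperatorSuperalgebra

variable {V : Type*} [AddCommGroup V] [Module ℂ V] (A : VertexOperatorSuperalgebra V)

/-- The mode `u(n)`: `Y(u,x) = ∑ₙ u(n) x^{-n-1}`. -/
def mode (u : V) (n : ℤ) : Module.End ℂ V := modeOf A.Y u n

theorem bijective_coeLinearMap : Function.Bijective (DirectSum.coeLinearMap A.gr) :=
  A.isInternal

/-- The projection of `V = ⨁ₖ gr k` onto `gr k`, that is, onto the vectors of weight `k / 2`. -/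
def proj (k : ℤ) : V →ₗ[ℂ] V :=
  (A.gr k).subtype ∘ₗ DirectSum.component ℂ ℤ (fun i => A.gr i) k ∘ₗ
    (LinearEquiv.ofBijective (DirectSum.coeLinearMap A.gr) A.bijective_coeLinearMap).symm.toLinearMap

/-! ### `X`-operators

Formal series in `y` involve half-integral powers of `y`: exponents of `y` are doubled, and the
argument `s : ℤ` stands for the power `y^{s/2}`. A vector `v` of weight `k/2` contributes to
`X(v,y) = Y(y^{L(0)}v,y) = y^{k/2} ∑ₙ v(n) y^{-n-1}` its mode `v(n)` at the power
`k/2 - n - 1 = s/2`, that is, for `k = s + 2n + 2`. -/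

/-- The coefficient of `y^{s/2}` in `X(v,y) = Y(y^{L(0)}v,y)`, for an arbitrary vector `v`. -/
def X (v : V) (s : ℤ) : Module.End ℂ V :=
  ∑ᶠ n : ℤ, A.mode (A.proj (s + 2 * n + 2) v) n

/-- The coefficient of `y^{s/2}` in the singular part of `X(v,y)`, that is, for homogeneous `v`, in
`y^{wt v}` times `Y⁺(v,y) = ∑_{n ≥ 0} v(n) y^{-n-1}`. -/
def XPlus (v : V) (s : ℤ) : Module.End ℂ V :=
  ∑ᶠ n : ℤ, if 0 ≤ n then A.mode (A.proj (s + 2 * n + 2) v) n else 0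

/-- The coefficient of `y^{s/2}` in the regular part of `X(v,y)`, that is, for homogeneous `v`, in
`y^{wt v}` times `Y⁻(v,y) = ∑_{n < 0} v(n) y^{-n-1}`. -/
def XMinus (v : V) (s : ℤ) : Module.End ℂ V :=
  ∑ᶠ n : ℤ, if n < 0 then A.mode (A.proj (s + 2 * n + 2) v) n else 0

/-- The coefficient of `y₁^{p/2} y₂^{q/2}` in the normal-ordered product `: X(u,y₁) X(v,y₂) :`.
For homogeneous `u`, `v` it is `y₁^{wt u} y₂^{wt v}` times
`: Y(u,y₁) Y(v,y₂) : = Y⁻(u,y₁) Y(v,y₂) + (-1)^{p(u)p(v)} Y(v,y₂) Y⁺(u,y₁)`, and it is extended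
bilinearly. (Only components of `u` of parity `p` and of `v` of parity `q` contribute to this
coefficient, so the sign is `(-1)^{pq}`.) -/
def normalOrd (u v : V) (p q : ℤ) : Module.End ℂ V :=
  A.XMinus u p * A.X v q + ((-1 : ℂ) ^ (p * q)) • (A.X v q * A.XPlus u p)

/-- The coefficient of `x^k y^{s/2}` in `: X(u,e^x y) X(v,y) :`, applied to `w`. -/
def normalOrdExp (u v : V) (k s : ℤ) (w : V) : V :=
  ∑ᶠ p : ℤ, (expL ((p : ℂ) / 2)).coeff k • A.normalOrd u v p (s - p) w

/-- The coefficient of `x₁^i x₂^j y^{s/2}` in `: X(u,e^{x₁} y) X(v,e^{x₂} y) :`, applied to `w`. -/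
def normalOrdExp₂ (u v : V) (i j s : ℤ) (w : V) : V :=
  ∑ᶠ p : ℤ, ((expL ((p : ℂ) / 2)).coeff i * (expL (((s - p : ℤ) : ℂ) / 2)).coeff j) •
    A.normalOrd u v p (s - p) w

/-! ### The operators `Y[u,x] = Y(e^{x L(0)} u, e^x - 1)` -/

/-- The coefficient of `x^k` in `Y[u,x]v = Y(e^{x L(0)} u, e^x - 1) v`: the sum, over all weights
`a/2` of components of `u`, of the coefficients of `e^{x a/2} ∑ₙ u(n)v (e^x-1)^{-n-1}`. -/
def bracketY (u v : V) (k : ℤ) : V :=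
  ∑ᶠ a : ℤ, ∑ᶠ n : ℤ,
    (expL ((a : ℂ) / 2) * expSubOne ^ (-n - 1)).coeff k • A.mode (A.proj a u) n v

/-- The coefficient of `x^k` in `e^{x a/2} Y⁺(u,e^x-1) v`, where
`Y⁺(u,x) = ∑_{n ≥ 0} u(n) x^{-n-1}`. -/
def singularY (a : ℤ) (u v : V) (k : ℤ) : V :=
  ∑ᶠ n : ℕ,
    (expL ((a : ℂ) / 2) * expSubOne ^ (-(n : ℤ) - 1)).coeff k • A.mode u n v

/-- The coefficient of `x^k y^{s/2}` in `X(Y[u,x]v,y)`. -/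
def iterate (u v : V) (k s : ℤ) : Module.End ℂ V := A.X (A.bracketY u v k) s

/-- The coefficient of `x₁^i x₂^j y^{s/2}` in `X(Y[u,x₁-x₂]v, e^{x₂} y)`. -/
def iterate₂ (u v : V) (i : ℤ) (j : ℕ) (s : ℤ) : Module.End ℂ V :=
  ∑ t ∈ Finset.HasAntidiagonal.antidiagonal j,
    (expL ((s : ℂ) / 2)).coeff (t.2 : ℤ) • A.X (atDiff (A.bracketY u v) i t.1) s

/-! ### Free pairs -/

/-- `u` of weight `a/2` and `v` of weight `b/2` form a free pair with constant `c`: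
`u(n)v = c δ_{wt u + wt v - 1, n} 𝟏` for all `n ≥ 0`. -/
def IsFreePair (a b : ℤ) (c : ℂ) (u v : V) : Prop :=
  u ∈ A.gr a ∧ v ∈ A.gr b ∧
    ∀ n : ℕ, A.mode u n v = if a + b = 2 * ((n : ℤ) + 1) then c • A.vacuum else 0

/-- Free fields: a vector `h` of weight `1` and a vector `φ` of weight `1/2` with
`h(n)h = δ_{n,1} 𝟏`, `φ(n)φ = δ_{n,0} 𝟏`, `h(n)φ = φ(n)h = 0` for all `n ≥ 0`. -/
def AreFreeFields (h φ : V) : Prop :=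
  h ∈ A.gr 2 ∧ φ ∈ A.gr 1 ∧ ∀ n : ℕ,
    A.mode h n h = (if n = 1 then A.vacuum else 0) ∧
    A.mode φ n φ = (if n = 0 then A.vacuum else 0) ∧
    A.mode h n φ = 0 ∧ A.mode φ n h = 0

/-- The coefficient of `x₁^i x₂^j y^{s/2}`, applied to `w`, in the `ζ`-regularized normal ordering
of `X(u,e^{x₁} y) X(v,e^{x₂} y)` for `u = α₁ h + β₁ φ` and `v = α₂ h + β₂ φ`, where `h`, `φ` are
free fields. It is bilinear, and
* for two bosons `h`, `h` it is `: X X : - ∂/∂x₁ (e^{x₁-x₂} / (e^{x₁-x₂} - 1))`,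
* for two fermions `φ`, `φ` it is `: X X : + e^{(x₁-x₂)/2} / (e^{x₁-x₂} - 1)`,
* for a boson and a fermion it is `: X X :`. -/
def zetaNormalOrd (h φ : V) (α₁ β₁ α₂ β₂ : ℂ) (i : ℤ) (j : ℕ) (s : ℤ) (w : V) : V :=
  A.normalOrdExp₂ (α₁ • h + β₁ • φ) (α₂ • h + β₂ • φ) i j s w +
    (if s = 0 then
      - (α₁ * α₂) * atDiff (LaurentSeries.hasseDeriv ℂ 1 (expL 1 / expSubOne)).coeff i j +
        (β₁ * β₂) * atDiff (expL (1 / 2) / expSubOne).coeff i j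
     else 0) • w

end VertexOperatorSuperalgebra

/-- The scalar correction term of a free pair of weights `a/2`, `b/2` and constant `c`:
`c e^{x a/2} / (e^x - 1)^{(a+b)/2}` if `(a+b)/2` is a positive integer. If it is not, then the
Kronecker symbol in the definition of a free pair is zero for all `n ≥ 0`, and so is the term. -/
def freeCorrection (a b : ℤ) (c : ℂ) : LaurentSeries ℂ :=
  if 0 < a + b ∧ Even (a + b) then
    c • (expL ((a : ℂ) / 2) / expSubOne ^ ((a + b) / 2))
  else 0

end

/-! ### The series `e^{ax}` and the powers of `e^x - 1` -/

/-! For homogeneous $u$ of weight $a/2$, split $Y[u,x]v=\sum_n e^{xa/2}(e^x-1)^{-n-1}u(n)v$ at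
$n=0$. The terms with $n\ge 0$ are the singular part. For $n=-j-1<0$, the Jacobi identity at
$l=-j-1$, $m=0$ expresses the modes of $u(-j-1)v$ through products $u(-M-1)v(\cdot)$ and
$v(\cdot)u(i)$ with $M,i\ge 0$, which are already in normal order (`mode_mode_neg`). Summing over
$j$, the coefficients become $e^{\alpha x}\sum_j\binom Mj(e^x-1)^j=e^{(\alpha+M)x}$ and $e^{\alpha
x}\sum_j(-1)^j\binom{i+j}{i}(e^x-1)^j=e^{(\alpha-i-1)x}$ with $\alpha=a/2$. These are the powers of
$e^x$ produced by $y_1=e^xy$ in the normal-ordered product (`finsum_mode_mode_neg`,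
`iterate_of_mem`).

The difference of the two sides, `contraction`, is bilinear. For a free pair the singular part is a
series times the vacuum, and $X(\mathbf 1,y)=1$, so the difference is a scalar supported at $y^0$.
The two-variable form follows by substituting $x=x_1-x_2$ and $y\mapsto e^{x_2}y$, which comes down
to $e^{\alpha(x_1-x_2)}e^{(\alpha+\beta)x_2}=e^{\alpha x_1}e^{\beta x_2}$. The $\zeta$-regularized
scalars are the free-pair corrections, because
$-\frac{d}{dx}\frac{e^x}{e^x-1}=\frac{e^x}{(e^x-1)^2}$. -/

theorem expL_add (a b : ℂ) : expL (a + b) = expL a * expL b := by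
  rw [expL, expL, expL, ← PowerSeries.coe_mul, PowerSeries.exp_mul_exp_eq_exp_add]

theorem expL_zero : expL 0 = 1 := by
  simp [expL]

theorem expL_natCast (n : ℕ) : expL n = (1 + expSubOne) ^ n := by
  rw [expSubOne, add_sub_cancel, expL, expL, ← PowerSeries.exp_pow_eq_rescale_exp]
  simp

theorem coeff_expL_natCast (a : ℂ) (n : ℕ) : (expL a).coeff n = a ^ n / n.factorial := by
  rw [expL, LaurentSeries.coeff_coe_powerSeries, PowerSeries.coeff_rescale, PowerSeries.coeff_exp]
  simp [div_eq_mul_inv]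

theorem coeff_expL_of_neg (a : ℂ) {k : ℤ} (hk : k < 0) : (expL a).coeff k = 0 := by
  rw [expL, PowerSeries.coeff_coe, if_pos hk]

theorem expSubOne_eq_single_mul :
    ∃ P : PowerSeries ℂ, P.constantCoeff = 1 ∧
      expSubOne = HahnSeries.single 1 1 * (P : LaurentSeries ℂ) := by
  refine ⟨PowerSeries.mk fun n => (1 / (n + 1).factorial : ℂ), by simp, ?_⟩
  have : PowerSeries.exp ℂ - 1 =
      PowerSeries.X * PowerSeries.mk fun n => (1 / (n + 1).factorial : ℂ) := by
    ext n
    cases n with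
    | zero => simp
    | succ n => simp [PowerSeries.coeff_succ_X_mul, PowerSeries.coeff_one, PowerSeries.coeff_exp]
  rw [← PowerSeries.coe_X, ← PowerSeries.coe_mul, ← this, expSubOne, expL]
  simp

theorem expSubOne_ne_zero : expSubOne ≠ 0 := by
  obtain ⟨P, hP, h⟩ := expSubOne_eq_single_mul
  rw [h]
  refine mul_ne_zero (by simp) fun h0 => ?_
  rw [← PowerSeries.coe_zero] at h0
  have := HahnSeries.ofPowerSeries_injective h0
  simp [this] at hP

/-- Since $(e^x-1)/x$ has constant term $1$, it is a unit of $\mathbb C[[x]]$. So powers of either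
sign have order at least the exponent, which makes each coefficient of $x^k$ below a finite sum. -/
theorem expSubOne_zpow (z : ℤ) :
    ∃ R : PowerSeries ℂ, expSubOne ^ z = HahnSeries.single z 1 * (R : LaurentSeries ℂ) := by
  obtain ⟨P, hP, h⟩ := expSubOne_eq_single_mul
  have hinv : (P : LaurentSeries ℂ)⁻¹ = ((P⁻¹ : PowerSeries ℂ) : LaurentSeries ℂ) := by
    symm
    apply eq_inv_of_mul_eq_one_left
    rw [← PowerSeries.coe_mul, PowerSeries.inv_mul_cancel _ (by simp [hP]), PowerSeries.coe_one]
  rw [h, mul_zpow, ← RatFunc.single_zpow z]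
  cases z with
  | ofNat n => exact ⟨P ^ n, by simp⟩
  | negSucc n => exact ⟨P⁻¹ ^ (n + 1), by
      rw [zpow_negSucc (P : LaurentSeries ℂ), PowerSeries.coe_pow, ← hinv, inv_pow]⟩

theorem coeff_coe_mul_expSubOne_zpow (Q : PowerSeries ℂ) {k z : ℤ} (h : k < z) :
    ((Q : LaurentSeries ℂ) * expSubOne ^ z).coeff k = 0 := by
  obtain ⟨R, hR⟩ := expSubOne_zpow z
  rw [hR, mul_left_comm, ← PowerSeries.coe_mul, HahnSeries.coeff_single_mul,
    PowerSeries.coeff_coe, if_pos (by lia), mul_zero]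

theorem coeff_expL_mul_expSubOne_zpow (a : ℂ) {k z : ℤ} (h : k < z) :
    (expL a * expSubOne ^ z).coeff k = 0 :=
  coeff_coe_mul_expSubOne_zpow _ h

theorem expSubOne_eq_coe :
    expSubOne = ((PowerSeries.exp ℂ - 1 : PowerSeries ℂ) : LaurentSeries ℂ) := by
  simp [expSubOne, expL]

/-- Binomial theorem for $e^{Mx}=(1+(e^x-1))^M$. Cutting at $K\ge k$ is harmless, as $(e^x-1)^j$ has
no $x^k$ term for $j>k$. The cut-off does not depend on $M$, so sums over $j$ and $M$ can be
exchanged later. -/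
theorem sum_choose_mul_coeff_expL (α : ℂ) (M K : ℕ) {k : ℤ} (hK : k ≤ K) :
    ∑ j ∈ Finset.range (K + 1), (M.choose j : ℂ) * (expL α * expSubOne ^ (j : ℤ)).coeff k =
      (expL (α + M)).coeff k := by
  have key : expL (α + M) = ∑ j ∈ Finset.range (M + 1),
      HahnSeries.C (M.choose j : ℂ) * (expL α * expSubOne ^ (j : ℤ)) := by
    rw [expL_add, expL_natCast, add_comm 1, add_pow, Finset.mul_sum]
    refine Finset.sum_congr rfl fun j _ => ?_
    rw [one_pow, mul_one, zpow_natCast, map_natCast]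
    ring
  rw [key, HahnSeries.coeff_sum]
  simp only [HahnSeries.C_mul_eq_smul, HahnSeries.coeff_smul, smul_eq_mul]
  rw [Finset.sum_subset (Finset.range_mono (show K + 1 ≤ max K M + 1 by lia)),
    Finset.sum_subset (Finset.range_mono (show M + 1 ≤ max K M + 1 by lia))]
  · intro j _ hj
    rw [Nat.choose_eq_zero_of_lt (by simpa using hj)]
    simp
  · intro j _ hj
    rw [coeff_expL_mul_expSubOne_zpow _ (by simp at hj; lia), mul_zero]

/-- The truncated binomial series of $(1+g)^{-i-1}$, with its error stated as a divisibility so that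
no inverse or infinite sum is needed. By Pascal's rule, multiplying the truncation for $i+1$ by
$1+g$ gives the one for $i$ plus a multiple of $g^{K+1}$. -/
theorem pow_dvd_one_add_pow_mul_sum {R : Type*} [CommRing R] (g : R) (i K : ℕ) :
    g ^ (K + 1) ∣ (1 + g) ^ (i + 1) *
      ∑ j ∈ Finset.range (K + 1), (-1) ^ j * ((i + j).choose i : R) * g ^ j - 1 := by
  induction i with
  | zero =>
    have h : ∀ K : ℕ, (1 + g) * ∑ j ∈ Finset.range (K + 1), (-1) ^ j * g ^ j =
        1 - (-1) ^ (K + 1) * g ^ (K + 1) := by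
      intro K
      induction K with
      | zero => simp
      | succ K ih => rw [Finset.sum_range_succ, mul_add, ih]; ring
    simp only [zero_add, pow_one, Nat.choose_zero_right, Nat.cast_one, mul_one, h]
    exact ⟨-(-1) ^ (K + 1), by ring⟩
  | succ i ih =>
    have h : ∀ K : ℕ, (1 + g) *
        ∑ j ∈ Finset.range (K + 1), (-1) ^ j * ((i + 1 + j).choose (i + 1) : R) * g ^ j =
        ∑ j ∈ Finset.range (K + 1), (-1) ^ j * ((i + j).choose i : R) * g ^ j +
          (-1) ^ K * ((i + 1 + K).choose (i + 1) : R) * g ^ (K + 1) := by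
      intro K
      induction K with
      | zero => simp
      | succ K ih =>
        rw [Finset.sum_range_succ, mul_add, ih, Finset.sum_range_succ _ (K + 1)]
        have : (i + 1 + (K + 1)).choose (i + 1) =
            (i + (K + 1)).choose i + (i + 1 + K).choose (i + 1) := by
          rw [show i + 1 + (K + 1) = (i + (K + 1)) + 1 by ring, Nat.choose_succ_succ]
          congr 2
          ring
        rw [this]
        push_cast
        ring
    rw [pow_succ (1 + g), mul_assoc, h, mul_add, add_sub_right_comm]
    exact dvd_add ih ⟨(1 + g) ^ (i + 1) * ((-1) ^ K * ((i + 1 + K).choose (i + 1) : R)), by ring⟩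

/-- The case $g=e^x-1$ of the truncated series, multiplied by $e^{(\alpha-i-1)x}$; the error is
divisible by $(e^x-1)^{K+1}$ and does not reach $x^k$. -/
theorem sum_neg_one_pow_mul_choose_mul_coeff_expL (α : ℂ) (i K : ℕ) {k : ℤ} (hK : k ≤ K) :
    ∑ j ∈ Finset.range (K + 1),
      (-1 : ℂ) ^ j * ((i + j).choose i : ℂ) * (expL α * expSubOne ^ (j : ℤ)).coeff k =
      (expL (α - i - 1)).coeff k := by
  obtain ⟨Q, hQ⟩ := pow_dvd_one_add_pow_mul_sum (PowerSeries.exp ℂ - 1) i K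
  have hQ' := congrArg (fun f : PowerSeries ℂ => expL (α - i - 1) * (f : LaurentSeries ℂ)) hQ
  have hE : ((1 + (PowerSeries.exp ℂ - 1) : PowerSeries ℂ) ^ (i + 1) : PowerSeries ℂ) =
      PowerSeries.rescale ((i + 1 : ℕ) : ℂ) (PowerSeries.exp ℂ) := by
    rw [add_sub_cancel, PowerSeries.exp_pow_eq_rescale_exp]
  rw [hE] at hQ'
  have hα : expL (α - i - 1) * expL ((i + 1 : ℕ) : ℂ) = expL α := by
    rw [← expL_add]; congr 1; push_cast; ring
  rw [PowerSeries.coe_sub, PowerSeries.coe_mul, PowerSeries.coe_mul, PowerSeries.coe_pow,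
    ← expSubOne_eq_coe, mul_sub, ← mul_assoc] at hQ'
  rw [show ((PowerSeries.rescale ((i + 1 : ℕ) : ℂ) (PowerSeries.exp ℂ) : PowerSeries ℂ) :
    LaurentSeries ℂ) = expL ((i + 1 : ℕ) : ℂ) from rfl, hα, PowerSeries.coe_one, mul_one,
    sub_eq_iff_eq_add, map_sum, Finset.mul_sum] at hQ'
  have := congrArg (fun f : LaurentSeries ℂ => f.coeff k) hQ'
  simp only [HahnSeries.coeff_add, HahnSeries.coeff_sum] at this
  have hz : (expL (α - i - 1) * (expSubOne ^ (K + 1) * (Q : LaurentSeries ℂ))).coeff k = 0 := by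
    rw [mul_left_comm, mul_comm, expL, ← PowerSeries.coe_mul, ← zpow_natCast]
    exact coeff_coe_mul_expSubOne_zpow _ (by push_cast; lia)
  rw [hz, zero_add] at this
  rw [← this]
  refine Finset.sum_congr rfl fun j _ => ?_
  rw [← smul_eq_mul, ← HahnSeries.coeff_smul, ← HahnSeries.C_mul_eq_smul, zpow_natCast]
  congr 1
  rw [PowerSeries.coe_mul, PowerSeries.coe_pow, ← expSubOne_eq_coe]
  simp only [map_mul, map_pow, map_neg, map_one, map_natCast]
  ring

/-! ### The derivative of a quotient of Laurent series -/

theorem coeff_single_one_mul_hasseDeriv (f : LaurentSeries ℂ) (n : ℤ) :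
    (HahnSeries.single 1 1 * LaurentSeries.hasseDeriv ℂ 1 f).coeff n = n * f.coeff n := by
  rw [HahnSeries.coeff_single_mul, LaurentSeries.hasseDeriv_coeff]
  simp

/-- After multiplication by $x$ the derivative becomes the Euler operator, which scales the
coefficient of $x^n$ by $n$ and does not enlarge supports. All three products are then sums over the
same index pairs, and the rule is $n=i+j$. -/
theorem hasseDeriv_one_mul (f g : LaurentSeries ℂ) :
    LaurentSeries.hasseDeriv ℂ 1 (f * g) =
      LaurentSeries.hasseDeriv ℂ 1 f * g + f * LaurentSeries.hasseDeriv ℂ 1 g := by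
  have hX : (HahnSeries.single 1 1 : LaurentSeries ℂ) ≠ 0 := by simp
  refine mul_left_cancel₀ hX ?_
  rw [mul_add, ← mul_assoc, mul_left_comm]
  ext n
  have hf : (HahnSeries.single 1 1 * LaurentSeries.hasseDeriv ℂ 1 f).support ⊆ f.support := by
    intro m hm
    rw [HahnSeries.mem_support, coeff_single_one_mul_hasseDeriv] at hm
    exact right_ne_zero_of_mul hm
  have hg : (HahnSeries.single 1 1 * LaurentSeries.hasseDeriv ℂ 1 g).support ⊆ g.support := by
    intro m hm
    rw [HahnSeries.mem_support, coeff_single_one_mul_hasseDeriv] at hm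
    exact right_ne_zero_of_mul hm
  rw [coeff_single_one_mul_hasseDeriv, HahnSeries.coeff_add,
    HahnSeries.coeff_mul_left' f.isPWO_support hf, HahnSeries.coeff_mul_right' g.isPWO_support hg,
    HahnSeries.coeff_mul, Finset.mul_sum, ← Finset.sum_add_distrib]
  refine Finset.sum_congr rfl fun ij h => ?_
  rw [coeff_single_one_mul_hasseDeriv, coeff_single_one_mul_hasseDeriv,
    ← (Finset.mem_antidiagonal.1 h).2.2]
  push_cast
  ring

theorem hasseDeriv_one_expL (a : ℂ) :
    LaurentSeries.hasseDeriv ℂ 1 (expL a) = HahnSeries.C a * expL a := by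
  ext n
  rw [LaurentSeries.hasseDeriv_coeff, HahnSeries.C_mul_eq_smul, HahnSeries.coeff_smul]
  rcases lt_trichotomy n (-1) with h | h | h
  · rw [coeff_expL_of_neg _ (by lia), coeff_expL_of_neg _ (by lia)]; simp
  -- At $n=-1$ the constant term of $e^{ax}$ is nonzero, but it is multiplied by $n+1=0$.
  · subst h
    rw [coeff_expL_of_neg _ (show (-1 : ℤ) < 0 by lia)]; simp
  · lift n to ℕ using by lia
    rw [show (n : ℤ) + ((1 : ℕ) : ℤ) = ((n + 1 : ℕ) : ℤ) by push_cast; ring, coeff_expL_natCast,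
      coeff_expL_natCast, Ring.choose_one_right, Nat.factorial_succ]
    have : (n : ℂ) + 1 ≠ 0 := by exact_mod_cast Nat.succ_ne_zero n
    have : (n.factorial : ℂ) ≠ 0 := by exact_mod_cast n.factorial_ne_zero
    simp only [zsmul_eq_mul, smul_eq_mul]
    push_cast
    field_simp
    ring

theorem hasseDeriv_one_expL_div_expSubOne :
    LaurentSeries.hasseDeriv ℂ 1 (expL 1 / expSubOne) = -(expL 1 / expSubOne ^ (2 : ℤ)) := by
  have h1 : LaurentSeries.hasseDeriv ℂ 1 (1 : LaurentSeries ℂ) = 0 := by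
    have := hasseDeriv_one_expL 0
    rwa [expL_zero, map_zero, zero_mul] at this
  have hg : LaurentSeries.hasseDeriv ℂ 1 expSubOne = expL 1 := by
    rw [expSubOne, map_sub, hasseDeriv_one_expL, h1, map_one, one_mul, sub_zero]
  -- The product rule for $\frac{e^x}{e^x-1}\cdot(e^x-1)=e^x$ is solved for the derivative of the
  -- quotient.
  have h := hasseDeriv_one_mul (expL 1 / expSubOne) expSubOne
  rw [div_mul_cancel₀ _ expSubOne_ne_zero, hasseDeriv_one_expL, map_one, one_mul, hg] at h
  have hne := expSubOne_ne_zero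
  have hE : expL 1 = 1 + expSubOne := by rw [expSubOne]; ring
  refine mul_right_cancel₀ hne ?_
  rw [← sub_eq_iff_eq_add] at h
  rw [← h, hE]
  field_simp
  ring

/-! ### Finite sums indexed by a support -/

theorem finsum_comp_of_support_subset_range {α β M : Type*} [AddCommMonoid M] (f : α → M)
    (g : β → α) (hg : Function.Injective g) (h : ∀ x, x ∉ Set.range g → f x = 0) :
    ∑ᶠ x, f x = ∑ᶠ y, f (g y) := by
  rw [← finsum_mem_range hg, finsum_mem_def]
  refine finsum_congr fun x => ?_
  by_cases hx : x ∈ Set.range g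
  · rw [Set.indicator_of_mem hx]
  · rw [Set.indicator_of_notMem hx, h x hx]

/-- Finiteness is essential: a `finsum` with infinite support is $0$ by convention, so splitting
could change the value. -/
theorem finsum_int_eq_add {M : Type*} [AddCommMonoid M] (f : ℤ → M) (hf : f.support.Finite) :
    ∑ᶠ n, f n = (∑ᶠ j : ℕ, f (-(j : ℤ) - 1)) + ∑ᶠ n : ℕ, f n := by
  have h : ∀ n, f n = (if n < 0 then f n else 0) + (if 0 ≤ n then f n else 0) := by
    intro n
    rcases lt_or_ge n 0 with hn | hn
    · simp [hn, hn.not_ge]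
    · simp [hn, hn.not_gt]
  rw [finsum_congr h, finsum_add_distrib]
  · rw [finsum_comp_of_support_subset_range _ (fun j : ℕ => -(j : ℤ) - 1)
        (fun i j hij => by simpa using hij),
      finsum_comp_of_support_subset_range (fun n => if 0 ≤ n then f n else 0)
        (fun j : ℕ => (j : ℤ)) Nat.cast_injective]
    · congr 1
      refine finsum_congr fun j => if_pos (by lia)
    · intro n hn
      refine if_neg fun h => hn ⟨n.toNat, by simp [h]⟩
    · intro n hn
      refine if_neg fun h => hn ⟨(-n - 1).toNat, by dsimp only; lia⟩
  · refine hf.subset fun n hn => ?_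
    simp only [Function.mem_support] at hn ⊢
    exact fun h => hn (by simp [h])
  · refine hf.subset fun n hn => ?_
    simp only [Function.mem_support] at hn ⊢
    exact fun h => hn (by simp [h])

namespace VertexOperatorSuperalgebra

variable {V : Type*} [AddCommGroup V] [Module ℂ V] (A : VertexOperatorSuperalgebra V)

/-! ### Modes -/

/-- The mode `u(n)`, as a linear function of `u`. -/
def modeLin (n : ℤ) : V →ₗ[ℂ] Module.End ℂ V where
  toFun u := A.mode u n
  map_add' u v := by simp [mode, modeOf]
  map_smul' c u := by simp [mode, modeOf]

@[simp]
theorem modeLin_apply (n : ℤ) (u : V) : A.modeLin n u = A.mode u n := rfl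

theorem exists_mode_eq_zero (u w : V) : ∃ N : ℕ, ∀ n : ℤ, N ≤ n → A.mode u n w = 0 := by
  refine ⟨(-(HahnSeries.order ((HahnModule.of ℂ).symm (A.Y u w)))).toNat, fun n hn => ?_⟩
  exact VertexOperator.ncoeff_eq_zero_of_lt_order _ _ _ (by lia)

theorem mode_jacobi {a b : ℤ} {u v : V} (hu : u ∈ A.gr a) (hv : v ∈ A.gr b) (w : V) (l m n : ℤ) :
    (∑ᶠ i : ℕ, ((-1 : ℤ) ^ i * Ring.choose l i) •
        A.mode u (l + m - i) (A.mode v (n + i) w)) -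
      ((-1 : ℂ) ^ (a * b) * (-1 : ℂ) ^ l) •
        (∑ᶠ i : ℕ, ((-1 : ℤ) ^ i * Ring.choose l i) •
          A.mode v (l + n - i) (A.mode u (m + i) w)) =
    ∑ᶠ i : ℕ, Ring.choose m i • A.mode (A.mode u (l + i) v) (m + n - i) w :=
  A.jacobi a b u v w hu hv l m n

/-! ### The grading -/

theorem coeLinearMap_symm_of_mem {b : ℤ} {v : V} (hv : v ∈ A.gr b) :
    (LinearEquiv.ofBijective (DirectSum.coeLinearMap A.gr) A.bijective_coeLinearMap).symm v =
      DirectSum.lof ℂ ℤ (fun i => A.gr i) b ⟨v, hv⟩ := by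
  rw [LinearEquiv.symm_apply_eq, LinearEquiv.ofBijective_apply, DirectSum.coeLinearMap_lof]

theorem proj_of_mem {b : ℤ} {v : V} (hv : v ∈ A.gr b) (k : ℤ) :
    A.proj k v = if k = b then v else 0 := by
  simp only [proj, LinearMap.comp_apply, LinearEquiv.coe_coe, coeLinearMap_symm_of_mem A hv]
  split_ifs with h
  · subst h
    rw [DirectSum.component.lof_self]; rfl
  · rw [DirectSum.component.of, dif_neg (Ne.symm h)]; rfl

theorem proj_mem (k : ℤ) (v : V) : A.proj k v ∈ A.gr k := Submodule.coe_mem _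

@[elab_as_elim]
theorem homogeneous_induction {P : V → Prop} (v : V)
    (mem : ∀ (b : ℤ) (v : V), v ∈ A.gr b → P v) (add : ∀ v w, P v → P w → P (v + w)) : P v := by
  have hv : v ∈ ⨆ i, A.gr i := by
    rw [A.isInternal.submodule_iSup_eq_top]; trivial
  exact Submodule.iSup_induction A.gr (motive := P) hv mem (mem 0 0 (zero_mem _)) add

theorem eq_zero_of_proj_eq_zero {v : V} (h : ∀ k, A.proj k v = 0) : v = 0 := by
  let e := LinearEquiv.ofBijective (DirectSum.coeLinearMap A.gr) A.bijective_coeLinearMap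
  have : e.symm v = 0 := by
    refine DFinsupp.ext fun k => ?_
    exact Subtype.ext (h k)
  simpa using this

theorem mem_of_proj_eq_zero {k : ℤ} {v : V} (h : ∀ i, i ≠ k → A.proj i v = 0) : v ∈ A.gr k := by
  have : v - A.proj k v = 0 := by
    refine A.eq_zero_of_proj_eq_zero fun i => ?_
    rw [map_sub, A.proj_of_mem (A.proj_mem k v)]
    split_ifs with hi
    · rw [hi, sub_self]
    · rw [h i hi, sub_zero]
  rw [sub_eq_zero.1 this]
  exact A.proj_mem k v

theorem finite_support_proj (v : V) : (Function.support fun k => A.proj k v).Finite := by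
  induction v using A.homogeneous_induction with
  | mem b v hv =>
    refine (Set.finite_singleton b).subset fun k hk => ?_
    simp only [Function.mem_support, A.proj_of_mem hv] at hk
    by_contra h
    exact hk (if_neg h)
  | add v w hv hw =>
    refine (hv.union hw).subset fun k hk => ?_
    simp only [Function.mem_support, map_add, Set.mem_union] at hk ⊢
    by_contra! h
    exact hk (by simp [h.1, h.2])

theorem proj_L_zero (i : ℤ) (v : V) :
    A.proj i (A.mode A.omega 1 v) = ((i : ℂ) / 2) • A.proj i v := by
  induction v using A.homogeneous_induction with
  | mem b v hv =>
    rw [mode, A.L_zero b v hv, map_smul, A.proj_of_mem hv]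
    split_ifs with h
    · rw [h]
    · simp
  | add v w hv hw => simp only [map_add, hv, hw, smul_add]

/-- Distinct weights are distinct eigenvalues of $L(0)$, so an eigenvector has only one homogeneous
component. -/
theorem mem_of_L_zero_eq {k : ℤ} {v : V} (h : A.mode A.omega 1 v = ((k : ℂ) / 2) • v) :
    v ∈ A.gr k := by
  refine A.mem_of_proj_eq_zero fun i hi => ?_
  have := A.proj_L_zero i v
  rw [h, map_smul, ← sub_eq_zero, ← sub_smul, smul_eq_zero] at this
  refine this.resolve_left fun h0 => hi ?_
  have : (k : ℂ) = i := by linear_combination 2 * h0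
  exact_mod_cast this.symm

/-- The Jacobi identity for $\omega,u$ at $l=0$, $m=1$ gives $[L(0),u(n)]=(L(-1)u)(n+1)+(L(0)u)(n)$,
and the $L(-1)$-derivative property turns the first term into $-(n+1)u(n)$. -/
theorem commutator_L_zero {a : ℤ} {u : V} (hu : u ∈ A.gr a) (n : ℤ) (w : V) :
    A.mode A.omega 1 (A.mode u n w) - A.mode u n (A.mode A.omega 1 w) =
      ((a : ℂ) / 2 - n - 1) • A.mode u n w := by
  have h := A.mode_jacobi A.omega_mem hu w 0 1 n
  rw [finsum_eq_single _ 0, finsum_eq_single _ 0,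
    finsum_eq_sum_of_support_subset (s := {0, 1})] at h
  · have h4 : (-1 : ℂ) ^ (4 * a) = 1 := Even.neg_one_zpow ⟨2 * a, by ring⟩
    simp [h4] at h
    rw [h, ← modeLin_apply A n, show A.mode A.omega 1 u = _ from A.L_zero a u hu, map_smul,
      show A.mode (A.mode A.omega 0 u) (1 + n) = _ from A.L_neg_one u (1 + n)]
    simp only [add_sub_cancel_left, LinearMap.smul_apply, modeLin_apply]
    rw [show modeOf A.Y u n = A.mode u n from rfl, ← add_smul]
    congr 1
    push_cast
    ring
  · intro i hi
    by_contra h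
    have : 2 ≤ i := by
      simp at h; lia
    refine hi ?_
    have h1 : Ring.choose (1 : ℤ) i = 0 := by
      have := Ring.choose_natCast (R := ℤ) 1 i
      rw [Nat.choose_eq_zero_of_lt (by lia)] at this
      exact_mod_cast this
    simp [h1]
  · intro i hi
    rw [Ring.choose_zero_pos _ (by lia)]; simp
  · intro i hi
    rw [Ring.choose_zero_pos _ (by lia)]; simp

/-- Not an axiom here, but a consequence of the $L(0)$-commutator. It determines which mode of
$u(n)v$ sits at a given power of $y$. -/
theorem mode_mem {a b : ℤ} {u v : V} (hu : u ∈ A.gr a) (hv : v ∈ A.gr b) (n : ℤ) :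
    A.mode u n v ∈ A.gr (a + b - 2 * n - 2) := by
  refine A.mem_of_L_zero_eq ?_
  have h := A.commutator_L_zero hu n v
  rw [show A.mode A.omega 1 v = _ from A.L_zero b v hv, map_smul, sub_eq_iff_eq_add,
    ← add_smul] at h
  rw [h]
  congr 1
  push_cast
  ring

/-- The sum `∑ₙ F n (v_{e(n)})` over the homogeneous components `v_k` of `v`. -/
noncomputable def projSum {M : Type*} [AddCommGroup M] [Module ℂ M] (e : ℤ → ℤ)
    (he : Function.Injective e) (F : ℤ → V →ₗ[ℂ] M) : V →ₗ[ℂ] M where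
  toFun v := ∑ᶠ n, F n (A.proj (e n) v)
  map_add' v w := by
    simp only [map_add]
    have h : ∀ v, (Function.support fun n => F n (A.proj (e n) v)).Finite := fun v =>
      ((A.finite_support_proj v).preimage he.injOn).subset fun n hn h =>
        hn (by simp only [h, map_zero])
    exact finsum_add_distrib (h v) (h w)
  map_smul' c v := by
    simp only [map_smul, RingHom.id_apply, smul_finsum]

theorem projSum_apply {M : Type*} [AddCommGroup M] [Module ℂ M] {e : ℤ → ℤ}
    (he : Function.Injective e) (F : ℤ → V →ₗ[ℂ] M) (v : V) :
    A.projSum e he F v = ∑ᶠ n, F n (A.proj (e n) v) := rfl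

theorem projSum_of_mem {M : Type*} [AddCommGroup M] [Module ℂ M] {e : ℤ → ℤ}
    (he : Function.Injective e) (F : ℤ → V →ₗ[ℂ] M) {v : V} {n : ℤ} (hv : v ∈ A.gr (e n)) :
    A.projSum e he F v = F n v := by
  rw [projSum_apply, finsum_eq_single _ n, A.proj_of_mem hv, if_pos rfl]
  intro m hm
  rw [A.proj_of_mem hv, if_neg fun h => hm (he h), map_zero]

theorem projSum_of_mem_of_notMem {M : Type*} [AddCommGroup M] [Module ℂ M] {e : ℤ → ℤ}
    (he : Function.Injective e) (F : ℤ → V →ₗ[ℂ] M) {v : V} {b : ℤ} (hv : v ∈ A.gr b)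
    (h : ∀ n, e n ≠ b) : A.projSum e he F v = 0 := by
  rw [projSum_apply]
  refine finsum_eq_zero_of_forall_eq_zero fun n => ?_
  rw [A.proj_of_mem hv, if_neg (h n), map_zero]

/-! ### The operators `X` and their regular and singular parts -/

theorem injective_add_two_mul (s : ℤ) : Function.Injective fun n : ℤ => s + 2 * n + 2 :=
  fun m n h => by dsimp only at h; lia

/-- `X(v,y)`, as a linear function of `v`. -/
noncomputable def XLin (s : ℤ) : V →ₗ[ℂ] Module.End ℂ V :=
  A.projSum _ (injective_add_two_mul s) A.modeLin

/-- The regular part of `X(v,y)`, as a linear function of `v`. -/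
noncomputable def XMinusLin (s : ℤ) : V →ₗ[ℂ] Module.End ℂ V :=
  A.projSum _ (injective_add_two_mul s) fun n => if n < 0 then A.modeLin n else 0

/-- The singular part of `X(v,y)`, as a linear function of `v`. -/
noncomputable def XPlusLin (s : ℤ) : V →ₗ[ℂ] Module.End ℂ V :=
  A.projSum _ (injective_add_two_mul s) fun n => if 0 ≤ n then A.modeLin n else 0

theorem XLin_apply (s : ℤ) (v : V) : A.XLin s v = A.X v s := rfl

theorem XMinusLin_apply (s : ℤ) (v : V) : A.XMinusLin s v = A.XMinus v s := by
  rw [XMinusLin, projSum_apply, XMinus]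
  refine finsum_congr fun n => ?_
  split_ifs <;> rfl

theorem XPlusLin_apply (s : ℤ) (v : V) : A.XPlusLin s v = A.XPlus v s := by
  rw [XPlusLin, projSum_apply, XPlus]
  refine finsum_congr fun n => ?_
  split_ifs <;> rfl

theorem X_of_mem {b s n : ℤ} {v : V} (hv : v ∈ A.gr b) (h : b = s + 2 * n + 2) :
    A.X v s = A.mode v n :=
  A.projSum_of_mem (injective_add_two_mul s) A.modeLin (n := n) (by rwa [← h])

theorem XMinus_of_mem {b s n : ℤ} {v : V} (hv : v ∈ A.gr b) (h : b = s + 2 * n + 2) :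
    A.XMinus v s = if n < 0 then A.mode v n else 0 := by
  rw [← XMinusLin_apply, XMinusLin, A.projSum_of_mem _ _ (n := n) (by rwa [← h])]
  split_ifs <;> rfl

theorem XPlus_of_mem {b s n : ℤ} {v : V} (hv : v ∈ A.gr b) (h : b = s + 2 * n + 2) :
    A.XPlus v s = if 0 ≤ n then A.mode v n else 0 := by
  rw [← XPlusLin_apply, XPlusLin, A.projSum_of_mem _ _ (n := n) (by rwa [← h])]
  split_ifs <;> rfl

theorem X_eq_zero {b s : ℤ} {v : V} (hv : v ∈ A.gr b) (h : ∀ n, s + 2 * n + 2 ≠ b) :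
    A.X v s = 0 :=
  A.projSum_of_mem_of_notMem (injective_add_two_mul s) A.modeLin hv h

theorem XMinus_eq_zero {b s : ℤ} {v : V} (hv : v ∈ A.gr b) (h : ∀ n, s + 2 * n + 2 ≠ b) :
    A.XMinus v s = 0 := by
  rw [← XMinusLin_apply]
  exact A.projSum_of_mem_of_notMem (injective_add_two_mul s) _ hv h

theorem XPlus_eq_zero {b s : ℤ} {v : V} (hv : v ∈ A.gr b) (h : ∀ n, s + 2 * n + 2 ≠ b) :
    A.XPlus v s = 0 := by
  rw [← XPlusLin_apply]
  exact A.projSum_of_mem_of_notMem (injective_add_two_mul s) _ hv h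

theorem X_vacuum (s : ℤ) : A.X A.vacuum s = if s = 0 then 1 else 0 := by
  by_cases h : ∃ n, s + 2 * n + 2 = 0
  · obtain ⟨n, hn⟩ := h
    rw [A.X_of_mem A.vacuum_mem hn.symm, mode, A.vacuum_mode]
    have : n = -1 ↔ s = 0 := by lia
    simp only [this]
  · push Not at h
    rw [A.X_eq_zero A.vacuum_mem h, if_neg fun h0 => h (-1) (by lia)]

end VertexOperatorSuperalgebra

/-- Upper negation, for the binomial coefficients of the Jacobi identity at $l=-j-1$. -/
theorem neg_one_pow_mul_choose_neg (j i : ℕ) :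
    (-1 : ℤ) ^ i * Ring.choose (-(j : ℤ) - 1) i = (j + i).choose i := by
  have h : -(j : ℤ) - 1 = -((j : ℤ) + 1) := by ring
  rw [h, Ring.choose_neg, show (j : ℤ) + 1 + i - 1 = ((j + i : ℕ) : ℤ) by push_cast; ring,
    Ring.choose_natCast, Int.negOnePow_def, Units.smul_def]
  simp [← mul_assoc, ← mul_pow]

namespace VertexOperatorSuperalgebra

variable {V : Type*} [AddCommGroup V] [Module ℂ V] (A : VertexOperatorSuperalgebra V)

/-! ### Normal-ordered products -/

/-- The modes `u(m) v(n)` and `ε v(n) u(m)`, in normal order. -/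
noncomputable def modeOrd (ε : ℂ) (u v : V) (m n : ℤ) (w : V) : V :=
  if m < 0 then A.mode u m (A.mode v n w) else ε • A.mode v n (A.mode u m w)

theorem normalOrd_of_mem {a b p q m n : ℤ} {u v : V} (hu : u ∈ A.gr a) (hv : v ∈ A.gr b)
    (hp : a = p + 2 * m + 2) (hq : b = q + 2 * n + 2) (w : V) :
    A.normalOrd u v p q w = A.modeOrd ((-1 : ℂ) ^ (a * b)) u v m n w := by
  -- $p\equiv a$ and $q\equiv b$ modulo $2$.
  have hs : (-1 : ℂ) ^ (p * q) = (-1 : ℂ) ^ (a * b) := by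
    have : a * b = p * q + 2 * (p * (n + 1) + (m + 1) * q + 2 * (m + 1) * (n + 1)) := by
      rw [hp, hq]; ring
    rw [this, zpow_add₀ (by simp), zpow_mul, zpow_mul (-1 : ℂ) 2]
    simp
  rw [normalOrd, A.XMinus_of_mem hu hp, A.XPlus_of_mem hu hp, A.X_of_mem hv hq, modeOrd, hs]
  rcases lt_or_ge m 0 with h | h
  · simp [h, h.not_ge]
  · simp [h, h.not_gt]

theorem normalOrd_eq_zero_left {a p : ℤ} {u : V} (hu : u ∈ A.gr a)
    (hp : ∀ m, p + 2 * m + 2 ≠ a) (v : V) (q : ℤ) : A.normalOrd u v p q = 0 := by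
  rw [normalOrd, A.XMinus_eq_zero hu hp, A.XPlus_eq_zero hu hp]
  simp

theorem normalOrd_eq_zero_right {b q : ℤ} {v : V} (hv : v ∈ A.gr b)
    (hq : ∀ n, q + 2 * n + 2 ≠ b) (u : V) (p : ℤ) : A.normalOrd u v p q = 0 := by
  rw [normalOrd, A.X_eq_zero hv hq]
  simp

theorem normalOrd_add_left (u₁ u₂ v : V) (p q : ℤ) :
    A.normalOrd (u₁ + u₂) v p q = A.normalOrd u₁ v p q + A.normalOrd u₂ v p q := by
  simp only [normalOrd, ← XMinusLin_apply, ← XPlusLin_apply, map_add, add_mul, mul_add, smul_add]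
  abel

theorem normalOrd_add_right (u v₁ v₂ : V) (p q : ℤ) :
    A.normalOrd u (v₁ + v₂) p q = A.normalOrd u v₁ p q + A.normalOrd u v₂ p q := by
  simp only [normalOrd, ← XLin_apply, map_add, add_mul, mul_add, smul_add]
  abel

theorem normalOrd_smul_left (c : ℂ) (u v : V) (p q : ℤ) :
    A.normalOrd (c • u) v p q = c • A.normalOrd u v p q := by
  simp only [normalOrd, ← XMinusLin_apply, ← XPlusLin_apply, map_smul, smul_mul_assoc,
    mul_smul_comm, smul_add, smul_comm c]

theorem normalOrd_smul_right (c : ℂ) (u v : V) (p q : ℤ) :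
    A.normalOrd u (c • v) p q = c • A.normalOrd u v p q := by
  simp only [normalOrd, ← XLin_apply, map_smul, smul_mul_assoc, mul_smul_comm, smul_add,
    smul_comm c]

/-- Normal ordering puts on the right the mode whose index grows: $v(N-m)$ as $m\to-\infty$, $u(m)$
as $m\to\infty$. Truncation then kills both tails. -/
theorem finite_support_modeOrd (ε : ℂ) (u v : V) (N : ℤ) (w : V) :
    (Function.support fun m => A.modeOrd ε u v m (N - m) w).Finite := by
  obtain ⟨S, hS⟩ := A.exists_mode_eq_zero u w
  obtain ⟨T, hT⟩ := A.exists_mode_eq_zero v w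
  refine (Set.finite_Icc (min (N - T) 0) S).subset fun m hm => ?_
  by_contra h
  rw [Set.mem_Icc, not_and_or, min_le_iff] at h
  refine hm ?_
  simp only [modeOrd]
  split_ifs with hm0
  · rw [hT _ (by lia), map_zero]
  · rw [hS _ (by lia), map_zero, smul_zero]

theorem mem_range_or_normalOrd_eq_zero {a : ℤ} {u : V} (hu : u ∈ A.gr a) (v : V) (s p : ℤ)
    (hp : p ∉ Set.range fun m : ℤ => a - 2 * m - 2) : A.normalOrd u v p (s - p) = 0 :=
  A.normalOrd_eq_zero_left hu (fun m hm => hp ⟨m, by dsimp only; lia⟩) v _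

theorem injective_sub_two_mul (a : ℤ) : Function.Injective fun m : ℤ => a - 2 * m - 2 :=
  fun m n h => by dsimp only at h; lia

theorem finite_support_normalOrd (u v : V) (s : ℤ) (w : V) :
    (Function.support fun p => A.normalOrd u v p (s - p) w).Finite := by
  induction u using A.homogeneous_induction with
  | add u₁ u₂ h₁ h₂ =>
    refine (h₁.union h₂).subset fun p hp => ?_
    simp only [Function.mem_support, normalOrd_add_left, LinearMap.add_apply, Set.mem_union] at hp ⊢
    by_contra! h
    exact hp (by simp [h.1, h.2])
  | mem a u hu =>
    induction v using A.homogeneous_induction with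
    | add v₁ v₂ h₁ h₂ =>
      refine (h₁.union h₂).subset fun p hp => ?_
      simp only [Function.mem_support, normalOrd_add_right, LinearMap.add_apply,
        Set.mem_union] at hp ⊢
      by_contra! h
      exact hp (by simp [h.1, h.2])
    | mem b v hv =>
      -- $N=m+n$ is the total index of $u(m)v(n)$, which occurs at $y^{s/2}$ with
      -- $s/2=\mathrm{wt}\,u+\mathrm{wt}\,v-N-2$; for $s$ of the other parity everything vanishes.
      by_cases hN : ∃ N, s = a + b - 2 * N - 4
      · obtain ⟨N, rfl⟩ := hN
        refine ((A.finite_support_modeOrd ((-1 : ℂ) ^ (a * b)) u v N w).image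
          fun m : ℤ => a - 2 * m - 2).subset fun p hp => ?_
        obtain ⟨m, rfl⟩ : p ∈ Set.range fun m : ℤ => a - 2 * m - 2 := by
          by_contra h
          exact hp (by simp [A.mem_range_or_normalOrd_eq_zero hu v _ p h])
        refine ⟨m, ?_, rfl⟩
        rw [Function.mem_support] at hp ⊢
        rwa [A.normalOrd_of_mem (m := m) (n := N - m) hu hv (by lia) (by lia)] at hp
      · push Not at hN
        refine Set.finite_empty.subset fun p hp => hp ?_
        dsimp only
        by_cases h : ∃ m, p + 2 * m + 2 = a
        · obtain ⟨m, hm⟩ := h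
          rw [A.normalOrd_eq_zero_right hv fun n hn => hN (m + n) (by lia)]; rfl
        · rw [A.normalOrd_eq_zero_left hu (by simpa using h)]; rfl

theorem normalOrdExp_of_mem {a b N : ℤ} {u v : V} (hu : u ∈ A.gr a) (hv : v ∈ A.gr b)
    (k : ℤ) (w : V) :
    A.normalOrdExp u v k (a + b - 2 * N - 4) w =
      ∑ᶠ m : ℤ, (expL ((a : ℂ) / 2 - m - 1)).coeff k •
        A.modeOrd ((-1 : ℂ) ^ (a * b)) u v m (N - m) w := by
  rw [normalOrdExp, finsum_comp_of_support_subset_range _ _ (injective_sub_two_mul a)]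
  · refine finsum_congr fun m => ?_
    rw [A.normalOrd_of_mem (m := m) (n := N - m) hu hv (by lia) (by lia)]
    congr 3
    push_cast
    ring
  · intro p hp
    rw [A.mem_range_or_normalOrd_eq_zero hu v _ p hp]
    simp

theorem normalOrdExp_eq_zero {a b s : ℤ} {u v : V} (hu : u ∈ A.gr a) (hv : v ∈ A.gr b)
    (hs : ∀ N, s ≠ a + b - 2 * N - 4) (k : ℤ) (w : V) : A.normalOrdExp u v k s w = 0 := by
  refine finsum_eq_zero_of_forall_eq_zero fun p => ?_
  by_cases h : ∃ m, p + 2 * m + 2 = a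
  · obtain ⟨m, hm⟩ := h
    rw [A.normalOrd_eq_zero_right hv fun n hn => hs (m + n) (by lia)]; simp
  · rw [A.normalOrd_eq_zero_left hu (by simpa using h)]; simp

/-! ### The iterate formula -/

/-- The Jacobi identity at $l=-j-1$, $m=0$, where $\binom0i$ leaves one term on the iterate side.
The factor $(-1)^l=-(-1)^j$ turns the difference into a sum. -/
theorem mode_mode_neg {a b : ℤ} {u v : V} (hu : u ∈ A.gr a) (hv : v ∈ A.gr b) (j : ℕ) (n : ℤ)
    (w : V) :
    A.mode (A.mode u (-(j : ℤ) - 1) v) n w =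
      (∑ᶠ i : ℕ, ((j + i).choose i : ℂ) •
        A.mode u (-(j : ℤ) - 1 - i) (A.mode v (n + i) w)) +
      ((-1 : ℂ) ^ (a * b) * (-1 : ℂ) ^ j) • ∑ᶠ i : ℕ, ((j + i).choose i : ℂ) •
        A.mode v (n - j - 1 - i) (A.mode u i w) := by
  have h := A.mode_jacobi hu hv w (-(j : ℤ) - 1) 0 n
  rw [finsum_eq_single (fun i : ℕ => Ring.choose (0 : ℤ) i • _) 0 (by
    intro i hi
    rw [Ring.choose_zero_pos _ (by lia), zero_smul])] at h
  simp only [neg_one_pow_mul_choose_neg, Ring.choose_zero_right, one_smul, Nat.cast_zero, add_zero,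
    zero_add, sub_zero, natCast_zsmul] at h
  rw [← h]
  have hsgn : (-1 : ℂ) ^ (-(j : ℤ) - 1) = -(-1 : ℂ) ^ j := by
    rw [zpow_sub₀ (by simp), zpow_neg, zpow_natCast, ← inv_pow]
    simp [div_neg]
  rw [hsgn, mul_neg, neg_smul, sub_neg_eq_add]
  simp only [Nat.cast_smul_eq_nsmul, show -(j : ℤ) - 1 + n = n - j - 1 by ring]

/-- The core of the argument: after the iterate formula and an exchange of finite sums, the two
binomial expansions in $e^x-1$ resum to pure exponentials. -/
theorem finsum_mode_mode_neg {a b N : ℤ} {u v : V} (hu : u ∈ A.gr a) (hv : v ∈ A.gr b) (α : ℂ)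
    (k : ℤ) (w : V) :
    ∑ᶠ j : ℕ, (expL α * expSubOne ^ (j : ℤ)).coeff k •
        A.mode (A.mode u (-(j : ℤ) - 1) v) (N + j + 1) w =
      (∑ᶠ j : ℕ, (expL (α + j)).coeff k • A.mode u (-(j : ℤ) - 1) (A.mode v (N + j + 1) w)) +
      ∑ᶠ i : ℕ, (expL (α - i - 1)).coeff k •
        ((-1 : ℂ) ^ (a * b) • A.mode v (N - i) (A.mode u i w)) := by
  obtain ⟨S, hS⟩ := A.exists_mode_eq_zero u w
  obtain ⟨T, hT⟩ := A.exists_mode_eq_zero v w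
  -- One cut-off, independent of $j$, beyond which both $u(i)w$ and $v(N+M+1)w$ vanish.
  obtain ⟨R, hR⟩ : ∃ R : ℕ, (S : ℤ) ≤ R ∧ (T : ℤ) ≤ N + R :=
    ⟨S + T + N.natAbs, by lia, by lia⟩
  set f : ℕ → V := fun M => A.mode u (-(M : ℤ) - 1) (A.mode v (N + M + 1) w) with hf
  set g : ℕ → V := fun i => A.mode v (N - i) (A.mode u i w) with hg
  have hfR : ∀ M, R ≤ M → f M = 0 := fun M hM => by
    rw [hf]; dsimp only; rw [hT _ (by lia), map_zero]
  have hgR : ∀ i, R ≤ i → g i = 0 := fun i hi => by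
    rw [hg]; dsimp only; rw [hS _ (by lia), map_zero]
  have key : ∀ (c : ℕ → ℂ) (h : ℕ → V), (∀ M, R ≤ M → h M = 0) →
      ∑ᶠ M, c M • h M = ∑ M ∈ Finset.range R, c M • h M := by
    intro c h hh
    refine finsum_eq_sum_of_support_subset _ fun M hM => ?_
    by_contra hM'
    exact hM (by simp [hh M (by simpa using hM')])
  have hmode : ∀ j : ℕ, A.mode (A.mode u (-(j : ℤ) - 1) v) (N + j + 1) w =
      (∑ M ∈ Finset.range R, (M.choose j : ℂ) • f M) +
      ∑ i ∈ Finset.range R, (-1 : ℂ) ^ j • ((i + j).choose i : ℂ) • (-1 : ℂ) ^ (a * b) • g i := by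
    intro j
    -- Reindex by $M=j+i$; the missing $M<j$ may be added since $\binom Mj=0$ there.
    rw [A.mode_mode_neg hu hv, ← key _ f hfR,
      finsum_comp_of_support_subset_range (fun M => (M.choose j : ℂ) • f M) (fun i => j + i)
        (fun i i' h => by simpa using h)]
    · congr 1
      · refine finsum_congr fun i => ?_
        rw [hf, Nat.choose_symm_add]
        dsimp only
        congr 3
        · push_cast; ring
        · congr 1; push_cast; ring
      · rw [finsum_congr fun i => ?_, key (fun i => ((j + i).choose i : ℂ)) g hgR, mul_comm,
          mul_smul, Finset.smul_sum, Finset.smul_sum]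
        · refine Finset.sum_congr rfl fun i _ => ?_
          rw [add_comm j i, smul_comm ((-1 : ℂ) ^ (a * b))]
        · rw [show N + (j : ℤ) + 1 - j - 1 - i = N - i by ring]
    · intro M hM
      rw [Nat.choose_eq_zero_of_lt, Nat.cast_zero, zero_smul]
      by_contra h
      exact hM ⟨M - j, by dsimp only; lia⟩
  have hk : k ≤ (k.toNat : ℤ) := k.self_le_toNat
  rw [key _ f hfR, key _ (fun i => (-1 : ℂ) ^ (a * b) • g i) (fun i hi => by simp [hgR i hi]),
    finsum_eq_sum_of_support_subset (s := Finset.range (k.toNat + 1))]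
  · simp only [hmode, smul_add, Finset.sum_add_distrib, Finset.smul_sum]
    congr 1
    · rw [Finset.sum_comm]
      refine Finset.sum_congr rfl fun M _ => ?_
      rw [← sum_choose_mul_coeff_expL α M _ hk, Finset.sum_smul]
      refine Finset.sum_congr rfl fun j _ => ?_
      rw [smul_smul, mul_comm]
    · rw [Finset.sum_comm]
      refine Finset.sum_congr rfl fun i _ => ?_
      rw [← sum_neg_one_pow_mul_choose_mul_coeff_expL α i _ hk, Finset.sum_smul]
      refine Finset.sum_congr rfl fun j _ => ?_
      simp only [smul_smul]
      congr 1
      ring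
  · intro j hj
    by_contra h
    refine hj ?_
    dsimp only
    rw [coeff_expL_mul_expSubOne_zpow _ (by simp at h; lia), zero_smul]

theorem finite_support_coeff_smul_mode (α : ℂ) (u v : V) (k : ℤ) :
    (Function.support fun n : ℤ =>
      (expL α * expSubOne ^ (-n - 1)).coeff k • A.mode u n v).Finite := by
  obtain ⟨S, hS⟩ := A.exists_mode_eq_zero u v
  refine (Set.finite_Icc (-k - 1) S).subset fun n hn => ?_
  by_contra h
  rw [Set.mem_Icc, not_and_or] at h
  refine hn ?_
  dsimp only
  rcases h with h | h
  · rw [coeff_expL_mul_expSubOne_zpow _ (by lia), zero_smul]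
  · rw [hS _ (by lia), smul_zero]

theorem bracketY_of_mem {a : ℤ} {u : V} (hu : u ∈ A.gr a) (v : V) (k : ℤ) :
    A.bracketY u v k =
      ∑ᶠ n : ℤ, (expL ((a : ℂ) / 2) * expSubOne ^ (-n - 1)).coeff k • A.mode u n v := by
  rw [bracketY, finsum_eq_single _ a]
  · simp only [A.proj_of_mem hu, if_true]
  · intro b hb
    refine finsum_eq_zero_of_forall_eq_zero fun n => ?_
    rw [A.proj_of_mem hu, if_neg hb, ← modeLin_apply, map_zero]
    simp

theorem bracketY_eq_add_singularY {a : ℤ} {u : V} (hu : u ∈ A.gr a) (v : V) (k : ℤ) :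
    A.bracketY u v k =
      (∑ᶠ j : ℕ, (expL ((a : ℂ) / 2) * expSubOne ^ (j : ℤ)).coeff k •
        A.mode u (-(j : ℤ) - 1) v) + A.singularY a u v k := by
  rw [A.bracketY_of_mem hu, finsum_int_eq_add _ (A.finite_support_coeff_smul_mode _ u v k),
    singularY]
  congr 1
  refine finsum_congr fun j => ?_
  rw [show -(-(j : ℤ) - 1) - 1 = (j : ℤ) by ring]

theorem iterate_of_mem {a b : ℤ} {u v : V} (hu : u ∈ A.gr a) (hv : v ∈ A.gr b) (k s : ℤ) (w : V) :
    A.iterate u v k s w = A.normalOrdExp u v k s w + A.X (A.singularY a u v k) s w := by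
  rw [iterate, A.bracketY_eq_add_singularY hu, ← XLin_apply, map_add, LinearMap.add_apply,
    XLin_apply A s (A.singularY a u v k)]
  congr 1
  have hfin : (Function.support fun j : ℕ => (expL ((a : ℂ) / 2) * expSubOne ^ (j : ℤ)).coeff k •
        A.mode u (-(j : ℤ) - 1) v).Finite := by
    refine (Set.finite_Iic k.toNat).subset fun j hj => ?_
    by_contra h
    refine hj ?_
    dsimp only
    rw [coeff_expL_mul_expSubOne_zpow _ (by simp at h; lia), zero_smul]
  -- Only $j\le k$ contribute, so $X(\cdot,y)w$ may be applied term by term.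
  have hmap := map_finsum ((A.XLin s).flip w) hfin
  rw [LinearMap.flip_apply] at hmap
  rw [hmap]
  by_cases hN : ∃ N, s = a + b - 2 * N - 4
  · obtain ⟨N, rfl⟩ := hN
    rw [A.normalOrdExp_of_mem hu hv, finsum_int_eq_add]
    · convert A.finsum_mode_mode_neg (N := N) hu hv ((a : ℂ) / 2) k w using 1
      · refine finsum_congr fun j => ?_
        rw [map_smul, LinearMap.flip_apply, XLin_apply,
          A.X_of_mem (n := N + j + 1) (A.mode_mem hu hv _) (by lia)]
      · congr 1
        · refine finsum_congr fun j => ?_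
          rw [modeOrd, if_pos (by lia)]
          congr 3
          · push_cast; ring
          · congr 1; ring
    · exact (A.finite_support_modeOrd _ u v N w).subset (Function.support_smul_subset_right _ _)
  · push Not at hN
    rw [A.normalOrdExp_eq_zero hu hv hN]
    refine finsum_eq_zero_of_forall_eq_zero fun j => ?_
    rw [map_smul, LinearMap.flip_apply, XLin_apply,
      A.X_eq_zero (A.mode_mem hu hv _) fun n hn => hN (n - j - 1) (by lia)]
    simp

end VertexOperatorSuperalgebra

/-! ### Two exponential variables -/

theorem atDiff_complex (f : ℤ → ℂ) (i : ℤ) (j : ℕ) :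
    atDiff f i j = ((-1 : ℤ) ^ j * Ring.choose (i + (j : ℤ)) j : ℤ) * f (i + j) := by
  rw [atDiff, zsmul_eq_mul]

theorem atDiff_linear (c d : ℂ) (f g : ℤ → ℂ) (i : ℤ) (j : ℕ) :
    atDiff (fun k => c * f k + d * g k) i j = c * atDiff f i j + d * atDiff g i j := by
  simp only [atDiff_complex]
  ring

/-- The coefficient of $x_1^ix_2^j$ in $e^{\alpha(x_1-x_2)}e^{(\alpha+\beta)x_2}=e^{\alpha
x_1}e^{\beta x_2}$. -/
theorem sum_antidiagonal_coeff_expL (α β : ℂ) (i : ℤ) (j : ℕ) :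
    ∑ t ∈ Finset.HasAntidiagonal.antidiagonal j,
      (expL (α + β)).coeff (t.2 : ℤ) * atDiff (expL α).coeff i t.1 =
      (expL α).coeff i * (expL β).coeff j := by
  simp only [atDiff_complex]
  rcases lt_or_ge i 0 with hi | hi
  · rw [coeff_expL_of_neg _ hi, zero_mul]
    refine Finset.sum_eq_zero fun t _ => ?_
    rcases lt_or_ge (i + (t.1 : ℤ)) 0 with h | h
    · rw [coeff_expL_of_neg _ h]; simp
    -- Here $0\le i+t_1<t_1$, so the binomial coefficient is zero.
    · obtain ⟨n, hn⟩ := Int.eq_ofNat_of_zero_le h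
      rw [hn, Ring.choose_natCast, Nat.choose_eq_zero_of_lt (by lia)]
      simp
  · lift i to ℕ using hi
    have hβ : expL β = expL (-α) * expL (α + β) := by rw [← expL_add]; congr 1; ring
    have hcoe : (expL β).coeff j = ∑ t ∈ Finset.HasAntidiagonal.antidiagonal j,
        (expL (-α)).coeff (t.1 : ℤ) * (expL (α + β)).coeff (t.2 : ℤ) := by
      rw [hβ]
      simp only [expL]
      rw [← PowerSeries.coe_mul, LaurentSeries.coeff_coe_powerSeries, PowerSeries.coeff_mul]
      simp only [LaurentSeries.coeff_coe_powerSeries]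
    rw [hcoe, Finset.mul_sum]
    refine Finset.sum_congr rfl fun t _ => ?_
    rw [← Nat.cast_add, Ring.choose_natCast, coeff_expL_natCast α, coeff_expL_natCast α,
      coeff_expL_natCast (-α), ← Nat.add_choose_mul_factorial_mul_factorial i t.1]
    have h1 : (i.factorial : ℂ) ≠ 0 := by exact_mod_cast i.factorial_ne_zero
    have h2 : (t.1.factorial : ℂ) ≠ 0 := by exact_mod_cast t.1.factorial_ne_zero
    have h3 : ((i + t.1).choose t.1 : ℂ) ≠ 0 := by
      exact_mod_cast (Nat.choose_pos (by lia)).ne'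
    push_cast
    rw [neg_pow α, pow_add]
    field_simp

namespace VertexOperatorSuperalgebra

variable {V : Type*} [AddCommGroup V] [Module ℂ V] (A : VertexOperatorSuperalgebra V)

/-! ### Bilinearity -/

/-- The coefficient of `x^k` in `e^{xa/2} Y(u,e^x - 1) v`, as a bilinear function of `u`, `v`. -/
noncomputable def expMode (a k : ℤ) : V →ₗ[ℂ] V →ₗ[ℂ] V :=
  LinearMap.mk₂ ℂ
    (fun u v => ∑ᶠ n : ℤ, (expL ((a : ℂ) / 2) * expSubOne ^ (-n - 1)).coeff k • A.mode u n v)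
    (fun u₁ u₂ v => by
      rw [← finsum_add_distrib (A.finite_support_coeff_smul_mode _ u₁ v k)
        (A.finite_support_coeff_smul_mode _ u₂ v k)]
      simp only [← modeLin_apply, map_add, LinearMap.add_apply, smul_add])
    (fun c u v => by
      rw [smul_finsum]
      simp only [← modeLin_apply, map_smul, LinearMap.smul_apply, smul_comm c])
    (fun u v₁ v₂ => by
      rw [← finsum_add_distrib (A.finite_support_coeff_smul_mode _ u v₁ k)
        (A.finite_support_coeff_smul_mode _ u v₂ k)]
      simp only [map_add, smul_add])
    (fun c u v => by
      rw [smul_finsum]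
      simp only [map_smul, smul_comm c])

theorem bracketY_eq_projSum (u v : V) (k : ℤ) :
    A.bracketY u v k = A.projSum id Function.injective_id (fun a => (A.expMode a k).flip v) u :=
  rfl

/-- `Y[u,x]v`, as a bilinear function of `u`, `v`. -/
noncomputable def bracketYLin (k : ℤ) : V →ₗ[ℂ] V →ₗ[ℂ] V :=
  have h : ∀ {a : ℤ} {u : V}, u ∈ A.gr a → ∀ v, A.bracketY u v k = A.expMode a k u v :=
    fun hu v => A.bracketY_of_mem hu v k
  LinearMap.mk₂ ℂ (fun u v => A.bracketY u v k)
    (fun u₁ u₂ v => by simp only [bracketY_eq_projSum, map_add])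
    (fun c u v => by simp only [bracketY_eq_projSum, map_smul])
    (fun u v₁ v₂ => by
      induction u using A.homogeneous_induction with
      | mem a u hu => simp only [h hu, map_add]
      | add u₁ u₂ h₁ h₂ =>
        simp only [bracketY_eq_projSum, map_add] at h₁ h₂ ⊢
        rw [h₁, h₂]; abel)
    (fun c u v => by
      induction u using A.homogeneous_induction with
      | mem a u hu => simp only [h hu, map_smul]
      | add u₁ u₂ h₁ h₂ =>
        simp only [bracketY_eq_projSum, map_add] at h₁ h₂ ⊢
        rw [h₁, h₂, smul_add])

theorem finite_support_smul_normalOrd (c : ℤ → ℂ) (u v : V) (s : ℤ) (w : V) :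
    (Function.support fun p => c p • A.normalOrd u v p (s - p) w).Finite :=
  (A.finite_support_normalOrd u v s w).subset (Function.support_smul_subset_right _ _)

/-- `: X(u,e^x y) X(v,y) :`, as a bilinear function of `u`, `v`. -/
noncomputable def normalOrdExpLin (k s : ℤ) (w : V) : V →ₗ[ℂ] V →ₗ[ℂ] V :=
  LinearMap.mk₂ ℂ (fun u v => A.normalOrdExp u v k s w)
    (fun u₁ u₂ v => by
      simp only [normalOrdExp]
      rw [← finsum_add_distrib (A.finite_support_smul_normalOrd _ u₁ v s w)
        (A.finite_support_smul_normalOrd _ u₂ v s w)]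
      simp only [normalOrd_add_left, LinearMap.add_apply, smul_add])
    (fun c u v => by
      simp only [normalOrdExp]
      rw [smul_finsum]
      simp only [normalOrd_smul_left, LinearMap.smul_apply, smul_comm c])
    (fun u v₁ v₂ => by
      simp only [normalOrdExp]
      rw [← finsum_add_distrib (A.finite_support_smul_normalOrd _ u v₁ s w)
        (A.finite_support_smul_normalOrd _ u v₂ s w)]
      simp only [normalOrd_add_right, LinearMap.add_apply, smul_add])
    (fun c u v => by
      simp only [normalOrdExp]
      rw [smul_finsum]
      simp only [normalOrd_smul_right, LinearMap.smul_apply, smul_comm c])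

/-- The difference `X(Y[u,x]v,y) - : X(u,e^x y) X(v,y) :`, as a bilinear function of `u`, `v`. -/
noncomputable def contraction (k s : ℤ) (w : V) : V →ₗ[ℂ] V →ₗ[ℂ] V :=
  (A.bracketYLin k).compr₂ ((A.XLin s).flip w) - A.normalOrdExpLin k s w

theorem contraction_apply (k s : ℤ) (w u v : V) :
    A.contraction k s w u v = A.iterate u v k s w - A.normalOrdExp u v k s w := rfl

theorem finite_support_singularY (a : ℤ) (u v : V) (k : ℤ) :
    (Function.support fun n : ℕ =>
      (expL ((a : ℂ) / 2) * expSubOne ^ (-(n : ℤ) - 1)).coeff k • A.mode u n v).Finite :=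
  (A.finite_support_coeff_smul_mode _ u v k).preimage Nat.cast_injective.injOn

theorem singularY_add_right (a : ℤ) (u v₁ v₂ : V) (k : ℤ) :
    A.singularY a u (v₁ + v₂) k = A.singularY a u v₁ k + A.singularY a u v₂ k := by
  simp only [singularY]
  rw [← finsum_add_distrib (A.finite_support_singularY a u v₁ k)
    (A.finite_support_singularY a u v₂ k)]
  simp only [map_add, smul_add]

/-- Both sides are additive in $v$, so the homogeneous case suffices; $u$ must stay homogeneous
because its weight enters through $e^{xa/2}$. -/
theorem contraction_of_mem {a : ℤ} {u : V} (hu : u ∈ A.gr a) (v : V) (k s : ℤ) (w : V) :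
    A.contraction k s w u v = A.X (A.singularY a u v k) s w := by
  induction v using A.homogeneous_induction with
  | mem b v hv => rw [contraction_apply, A.iterate_of_mem hu hv, add_sub_cancel_left]
  | add v₁ v₂ h₁ h₂ =>
    rw [map_add, h₁, h₂, singularY_add_right, ← XLin_apply A s (_ + _), map_add]
    rfl

/-! ### Free pairs -/

theorem singularY_of_isFreePair {a b : ℤ} {c : ℂ} {u v : V} (h : A.IsFreePair a b c u v) (k : ℤ) :
    A.singularY a u v k = (freeCorrection a b c).coeff k • A.vacuum := by
  obtain ⟨-, -, h⟩ := h
  simp only [singularY, h]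
  by_cases hab : 0 < a + b ∧ Even (a + b)
  · obtain ⟨hpos, r, hr⟩ := hab
    -- With $r=(a+b)/2\ge1$, only $n=r-1$ survives, and $-n-1=-r$ is the exponent in the correction
    -- term.
    rw [finsum_eq_single _ (r - 1).toNat, if_pos (by lia), freeCorrection, if_pos ⟨hpos, r, hr⟩,
      HahnSeries.coeff_smul, smul_smul, smul_eq_mul, mul_comm c, div_eq_mul_inv (expL _),
        ← zpow_neg]
    · congr 5
      lia
    · intro n hn
      rw [if_neg (by lia), smul_zero]
  · rw [freeCorrection, if_neg hab, finsum_eq_zero_of_forall_eq_zero, HahnSeries.coeff_zero,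
      zero_smul]
    intro n
    rw [if_neg fun hn => hab ⟨by lia, (n : ℤ) + 1, by lia⟩, smul_zero]

theorem contraction_of_isFreePair {a b : ℤ} {c : ℂ} {u v : V} (h : A.IsFreePair a b c u v)
    (k s : ℤ) (w : V) :
    A.contraction k s w u v = (if s = 0 then (freeCorrection a b c).coeff k else 0) • w := by
  rw [A.contraction_of_mem h.1, A.singularY_of_isFreePair h, ← XLin_apply, map_smul, XLin_apply,
    X_vacuum]
  split_ifs <;> simp

/-! ### Two variables -/

theorem iterate₂_apply (u v : V) (i : ℤ) (j : ℕ) (s : ℤ) (w : V) :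
    A.iterate₂ u v i j s w = ∑ t ∈ Finset.HasAntidiagonal.antidiagonal j,
      (expL ((s : ℂ) / 2)).coeff (t.2 : ℤ) •
        atDiff (fun k => A.iterate u v k s w) i t.1 := by
  rw [iterate₂, LinearMap.sum_apply]
  refine Finset.sum_congr rfl fun t _ => ?_
  rw [LinearMap.smul_apply, atDiff, atDiff, ← XLin_apply, map_zsmul]
  rfl

theorem normalOrdExp₂_eq_sum (u v : V) (i : ℤ) (j : ℕ) (s : ℤ) (w : V) :
    A.normalOrdExp₂ u v i j s w = ∑ t ∈ Finset.HasAntidiagonal.antidiagonal j,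
      (expL ((s : ℂ) / 2)).coeff (t.2 : ℤ) •
        atDiff (fun k => A.normalOrdExp u v k s w) i t.1 := by
  -- One finite set of $p$ serves all coefficient functions, so the sums over $p$ and the
  -- antidiagonal commute.
  have key : ∀ c : ℤ → ℂ, ∑ᶠ p : ℤ, c p • A.normalOrd u v p (s - p) w =
      ∑ p ∈ (A.finite_support_normalOrd u v s w).toFinset, c p • A.normalOrd u v p (s - p) w := by
    intro c
    refine finsum_eq_sum_of_support_subset _ ?_
    rw [Set.Finite.coe_toFinset]
    exact Function.support_smul_subset_right _ _
  simp only [normalOrdExp₂, normalOrdExp, key, atDiff, Finset.smul_sum]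
  rw [Finset.sum_comm]
  refine Finset.sum_congr rfl fun p _ => ?_
  have h := sum_antidiagonal_coeff_expL ((p : ℂ) / 2) (((s - p : ℤ) : ℂ) / 2) i j
  rw [show (p : ℂ) / 2 + ((s - p : ℤ) : ℂ) / 2 = (s : ℂ) / 2 by push_cast; ring] at h
  rw [← h, Finset.sum_smul]
  refine Finset.sum_congr rfl fun t _ => ?_
  rw [atDiff, mul_smul, smul_assoc]

theorem iterate₂_eq_add {u v : V} {s : ℤ} {w : V} {f : ℤ → ℂ}
    (h : ∀ k, A.contraction k s w u v = (if s = 0 then f k else 0) • w) (i : ℤ) (j : ℕ) :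
    A.iterate₂ u v i j s w =
      A.normalOrdExp₂ u v i j s w + (if s = 0 then atDiff f i j else 0) • w := by
  have hk : ∀ k, A.iterate u v k s w =
      A.normalOrdExp u v k s w + (if s = 0 then f k else 0) • w := fun k => by
    rw [← h, contraction_apply, add_sub_cancel]
  rw [iterate₂_apply, normalOrdExp₂_eq_sum]
  simp only [hk, atDiff, smul_add, Finset.sum_add_distrib]
  congr 1
  split_ifs with hs
  · subst hs
    -- The correction lives at $y^0$, where $e^{x_2s/2}=1$, so only the constant term in the second
    -- factor remains.
    rw [Finset.sum_eq_single (j, 0)]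
    · simp only [Int.cast_zero, zero_div, expL_zero, Nat.cast_zero, HahnSeries.coeff_one, if_true,
        one_smul, smul_assoc]
    · rintro ⟨m, n⟩ hmn hne
      have hn : n ≠ 0 := by
        rintro rfl
        exact hne (by simpa using hmn)
      simp [expL_zero, HahnSeries.coeff_one, hn]
    · simp
  · simp

/-! ### Free fields and the $\zeta$-regularized scalars -/

theorem isFreePair_of_areFreeFields {h φ : V} (H : A.AreFreeFields h φ) :
    A.IsFreePair 2 2 1 h h ∧ A.IsFreePair 1 1 1 φ φ ∧
      A.IsFreePair 2 1 0 h φ ∧ A.IsFreePair 1 2 0 φ h := by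
  obtain ⟨hh, hφ, H⟩ := H
  refine ⟨⟨hh, hh, fun n => ?_⟩, ⟨hφ, hφ, fun n => ?_⟩, ⟨hh, hφ, fun n => ?_⟩,
    ⟨hφ, hh, fun n => ?_⟩⟩
  · rw [(H n).1, one_smul]
    exact if_congr (by lia) rfl rfl
  · rw [(H n).2.1, one_smul]
    exact if_congr (by lia) rfl rfl
  · rw [(H n).2.2.1, zero_smul, ite_self]
  · rw [(H n).2.2.2, zero_smul, ite_self]

/-- Bilinearity reduces to four free pairs: the mixed ones have constant $0$, while $(h,h)$ and
$(\varphi,\varphi)$ give $e^x/(e^x-1)^2$ and $e^{x/2}/(e^x-1)$. -/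
theorem contraction_of_areFreeFields {h φ : V} (H : A.AreFreeFields h φ) (α₁ β₁ α₂ β₂ : ℂ)
    (k s : ℤ) (w : V) :
    A.contraction k s w (α₁ • h + β₁ • φ) (α₂ • h + β₂ • φ) =
      (if s = 0 then
        -(α₁ * α₂) * (LaurentSeries.hasseDeriv ℂ 1 (expL 1 / expSubOne)).coeff k +
          (β₁ * β₂) * (expL (1 / 2) / expSubOne).coeff k
      else 0) • w := by
  obtain ⟨h₁, h₂, h₃, h₄⟩ := A.isFreePair_of_areFreeFields H
  have hhh : (freeCorrection 2 2 1).coeff k =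
      -(LaurentSeries.hasseDeriv ℂ 1 (expL 1 / expSubOne)).coeff k := by
    rw [hasseDeriv_one_expL_div_expSubOne, freeCorrection, if_pos ⟨by lia, 2, by lia⟩]
    simp
  have hφφ : (freeCorrection 1 1 1).coeff k = (expL (1 / 2) / expSubOne).coeff k := by
    rw [freeCorrection, if_pos ⟨by lia, 1, by lia⟩]
    simp
  have hodd : ∀ a b : ℤ, (freeCorrection a b 0).coeff k = 0 := by
    intro a b
    rw [freeCorrection]
    split_ifs
    · rw [HahnSeries.coeff_smul, zero_smul]
    · rfl
  simp only [map_add, map_smul, LinearMap.add_apply, LinearMap.smul_apply,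
    A.contraction_of_isFreePair h₁, A.contraction_of_isFreePair h₂,
    A.contraction_of_isFreePair h₃, A.contraction_of_isFreePair h₄, hhh, hφφ, hodd]
  split_ifs
  · module
  · simp

end VertexOperatorSuperalgebra

theorem mainTheorem12 {V : Type*} [AddCommGroup V] [Module ℂ V]
    (A : VertexOperatorSuperalgebra V) :
    -- the general identity, for `u` homogeneous of weight `a / 2`
    (∀ (a : ℤ) (u v : V), u ∈ A.gr a → ∀ (k s : ℤ) (w : V),
      A.iterate u v k s w =
        A.normalOrdExp u v k s w + A.X (A.singularY a u v k) s w) ∧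
    -- free pairs
    (∀ (a b : ℤ) (c : ℂ) (u v : V), A.IsFreePair a b c u v → ∀ (k s : ℤ) (w : V),
      A.iterate u v k s w =
        A.normalOrdExp u v k s w +
          (if s = 0 then (freeCorrection a b c).coeff k else 0) • w) ∧
    -- free pairs, with two exponential variables
    (∀ (a b : ℤ) (c : ℂ) (u v : V), A.IsFreePair a b c u v →
      ∀ (i : ℤ) (j : ℕ) (s : ℤ) (w : V),
      A.iterate₂ u v i j s w =
        A.normalOrdExp₂ u v i j s w +
          (if s = 0 then atDiff (freeCorrection a b c).coeff i j else 0) • w) ∧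
    -- the `ζ`-regularized normal ordering of free fields is given by iterates
    (∀ h φ : V, A.AreFreeFields h φ → ∀ (α₁ β₁ α₂ β₂ : ℂ) (i : ℤ) (j : ℕ) (s : ℤ) (w : V),
      A.zetaNormalOrd h φ α₁ β₁ α₂ β₂ i j s w =
        A.iterate₂ (α₁ • h + β₁ • φ) (α₂ • h + β₂ • φ) i j s w) := by
  refine ⟨fun a u v hu k s w => ?_, fun a b c u v h k s w => ?_, fun a b c u v h i j s w => ?_,
    fun h φ H α₁ β₁ α₂ β₂ i j s w => ?_⟩
  · rw [← A.contraction_of_mem hu, A.contraction_apply, add_sub_cancel]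
  · rw [← A.contraction_of_isFreePair h, A.contraction_apply, add_sub_cancel]
  · exact A.iterate₂_eq_add (fun k => A.contraction_of_isFreePair h k s w) i j
  · rw [A.iterate₂_eq_add (fun k => A.contraction_of_areFreeFields H α₁ β₁ α₂ β₂ k s w) i j,
      atDiff_linear]
    rfl
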